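/- For a metric space $(X,d)$ put $\operatorname{Sp}(X)=\{d(x,y): x,y\in X\}$. For a nonempty finite ultrametric space $(X,d)$ the \emph{representing tree} $T_X$ is the rooted tree whose root is the set $X$ and which is built recursively: if a node $A\subseteq X$ satisfies $\operatorname{diam} A>0$, then its children are the parts of the complete multipartite graph on $A$ in which two points are adjacent if and only if their distance equals $\operatorname{diam} A$; if $\operatorname{diam} A=0$, then $A$ is a leaf. Write $\simeq$ for isomorphism of rooted trees (a graph isomorphism mapping root to root; node labels are disregarded). A nonempty finite ultrametric space $X$ is called \emph{tree-spectrum isometric} if every nonempty finite ultrametric space $Y$ with $T_X\simeq T_Y$ and $\operatorname{Sp}(X)=\operatorname{Sp}(Y)$ is isometric to $X$. In a rooted tree $T$, the level of a node is its distance (number of edges) to the root, the out-degree $\delta^+(v)$ is the number of children of $v$, a leaf is a node with no children, an internal node is a node that is not a leaf, and the height $h(T)$ is the maximum of the levels of the leaves. \textbf{Theorem.} Let $T$ be a finite rooted tree such that $\delta^+(u)\ge 2$ for every internal node $u$. Then the following conditions are equivalent. (i) $T$ has exactly one internal node on each level $k$ with $1\le k\le h(T)-2$ and at most two internal nodes on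 the level $h(T)-1$; moreover, if $u\neq v$ are internal nodes, both on the level $h(T)-1$, then $\delta^+(u)=\delta^+(v)$. (ii) Every nonempty finite ultrametric space $X$ with $T_X\simeq T$ is tree-spectrum isometric. -/

import Mathlib

/-- A rooted tree on the vertex set `V`: a connected acyclic graph with a distinguished vertex. -/
structure RootedGraphTree (V : Type*) where
  graph : SimpleGraph V
  isTree : graph.IsTree
  root : V

namespace RootedGraphTree

variable {V W : Type*}

/-- The level of a node: the number of edges of the path joining it to the root. -/
noncomputable def level (T : RootedGraphTree V) (v : V) : ℕ := T.graph.dist T.root v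

/-- The children (direct successors) of `v`: the neighbours of `v` one level below `v`. -/
def children (T : RootedGraphTree V) (v : V) : Set V :=
  {w | T.graph.Adj v w ∧ T.level w = T.level v + 1}

/-- The out-degree of `v`, i.e. the number of its children. -/
noncomputable def outDegree (T : RootedGraphTree V) (v : V) : ℕ := (T.children v).ncard

/-- A leaf is a node without children (in the one-node tree the root is a leaf). -/
def IsLeaf (T : RootedGraphTree V) (v : V) : Prop := T.children v = ∅

/-- An internal node is a node which is not a leaf. -/
def IsInternal (T : RootedGraphTree V) (v : V) : Prop := ¬ T.IsLeaf v

/-- The height: the largest level of a leaf. -/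
noncomputable def height (T : RootedGraphTree V) : ℕ := sSup (T.level '' {v | T.IsLeaf v})

/-- Isomorphism of rooted trees: an adjacency-preserving bijection taking root to root. -/
def Isomorphic (S : RootedGraphTree V) (T : RootedGraphTree W) : Prop :=
  ∃ f : S.graph ≃g T.graph, f S.root = T.root

end RootedGraphTree

namespace FiniteUltrametric

open Metric

section Nodes

variable {X : Type*} [MetricSpace X]

/-- The spectrum of a metric space: the set of all values of the distance. -/
def spectrum (X : Type*) [MetricSpace X] : Set ℝ :=
  Set.range fun p : X × X => dist p.1 p.2

/-- `B` is one of the parts of the diametrical graph of `A` (the complete multipartite graph in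
which two points of `A` are adjacent iff their distance is `diam A`), where `0 < diam A`:
`B` consists of the points of `A` not adjacent to some fixed point `a` of `A`. -/
def IsPart (A B : Set X) : Prop :=
  0 < diam A ∧ ∃ a ∈ A, B = {x ∈ A | dist a x < diam A}

/-- The nodes of the representing tree: the whole space, and, with every node `A` of positive
diameter, all parts of the diametrical graph of `A`. -/
inductive IsNode : Set X → Prop
  | root : IsNode Set.univ
  | part {A B : Set X} : IsNode A → IsPart A B → IsNode B

/-- The set of nodes of the representing tree of `X`. -/
abbrev Node (X : Type*) [MetricSpace X] : Type _ := {A : Set X // IsNode A}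

/-- The representing tree as a graph: the edges join a node of positive diameter with the parts of
its diametrical graph. -/
def reprGraph (X : Type*) [MetricSpace X] : SimpleGraph (Node X) :=
  SimpleGraph.fromRel fun A B => IsPart A.1 B.1

end Nodes

section IsTree

variable {X : Type*} [MetricSpace X] [IsUltrametricDist X] [Finite X]

theorem IsPart.diam_lt {A B : Set X} (h : IsPart A B) : diam B < diam A := by
  obtain ⟨h0, a, -, rfl⟩ := h
  set B : Set X := {x ∈ A | dist a x < diam A} with hB
  have hlt : ∀ x ∈ B, ∀ y ∈ B, dist x y < diam A := fun x hx y hy =>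
    (dist_triangle_max x a y).trans_lt (max_lt (by rw [dist_comm]; exact hx.2) hy.2)
  rcases B.eq_empty_or_nonempty with he | hne
  · rw [he, diam_empty]; exact h0
  · obtain ⟨p, hp, hmax⟩ := Set.exists_max_image (B ×ˢ B) (fun p : X × X => dist p.1 p.2)
      (Set.toFinite _) (hne.prod hne)
    exact (diam_le_of_forall_dist_le dist_nonneg
      fun x hx y hy => hmax (x, y) ⟨hx, hy⟩).trans_lt (hlt p.1 hp.1 p.2 hp.2)

theorem IsNode.diam_lt_dist {A : Set X} (h : IsNode A) {a x : X} (ha : a ∈ A) (hx : x ∉ A) :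
    diam A < dist a x := by
  induction h with
  | root => exact absurd (Set.mem_univ x) hx
  | @part A B _ hAB ih =>
    have hlt := hAB.diam_lt
    obtain ⟨h0, c, hc, rfl⟩ := hAB
    by_cases hxA : x ∈ A
    · refine hlt.trans_le ?_
      by_contra hcon
      push Not at hcon
      exact hx ⟨hxA, (dist_triangle_max c a x).trans_lt (max_lt ha.2 hcon)⟩
    · exact hlt.trans (ih ha.1 hxA)

theorem IsNode.parent_unique {A A' B : Set X} (hA : IsNode A) (hA' : IsNode A')
    (h : IsPart A B) (h' : IsPart A' B) : A = A' := by
  have key : ∀ {A A' : Set X}, IsNode A → IsNode A' → IsPart A B → IsPart A' B →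
      diam A ≤ diam A' → A ⊆ A' := by
    intro A A' hA hA' h h' hle x hx
    obtain ⟨h0, a, ha, hB⟩ := h
    obtain ⟨-, a', -, hB'⟩ := h'
    have haB : a ∈ B := by rw [hB]; exact ⟨ha, by simpa using h0⟩
    have haA' : a ∈ A' := by rw [hB'] at haB; exact haB.1
    by_contra hx'
    exact absurd (hA'.diam_lt_dist haA' hx')
      (not_lt.2 ((dist_le_diam_of_mem (Set.toFinite A).isBounded ha hx).trans hle))
  have aux : ∀ {A A' : Set X}, IsNode A → IsNode A' → IsPart A B → IsPart A' B →
      ¬ diam A < diam A' := by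
    intro A A' hA hA' h h' hlt
    have hsub := key hA hA' h h' hlt.le
    have hd := h.diam_lt
    obtain ⟨h0, a, ha, hB⟩ := h
    obtain ⟨-, a', -, hB'⟩ := h'
    have haB : a ∈ B := by rw [hB]; exact ⟨ha, by simpa using h0⟩
    have : A ⊆ B := by
      intro x hx
      have hax := dist_le_diam_of_mem (Set.toFinite A).isBounded ha hx
      rw [hB'] at haB ⊢
      exact ⟨hsub hx, (dist_triangle_max a' a x).trans_lt (max_lt haB.2 (hax.trans_lt hlt))⟩
    exact absurd (diam_mono this (Set.toFinite B).isBounded) (not_le.2 hd)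
  have heq : diam A = diam A' :=
    le_antisymm (not_lt.1 (aux hA' hA h' h)) (not_lt.1 (aux hA hA' h h'))
  exact (key hA hA' h h' heq.le).antisymm (key hA' hA h' h heq.ge)

theorem reprGraph_isTree : (reprGraph X).IsTree := by
  have hne : ∀ {A B : Node X}, IsPart A.1 B.1 → A ≠ B := by
    rintro A B h rfl
    exact lt_irrefl _ h.diam_lt
  refine ⟨(SimpleGraph.connected_iff_exists_forall_reachable _).2
    ⟨⟨Set.univ, .root⟩, ?_⟩, ?_⟩
  · rintro ⟨A, hA⟩
    induction hA with
    | root => exact SimpleGraph.Reachable.refl _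
    | @part A B hA hAB ih =>
      refine ih.trans (SimpleGraph.Adj.reachable ?_)
      exact ⟨hne (A := ⟨A, hA⟩) (B := ⟨B, hA.part hAB⟩) hAB, Or.inl hAB⟩
  · intro v c hc
    obtain ⟨m, hm, hmin⟩ := Set.exists_min_image {w | w ∈ c.support}
      (fun w : Node X => diam w.1) (Set.toFinite _) ⟨v, c.start_mem_support⟩
    classical
    have hc' := hc.rotate hm
    have hpar : ∀ w ∈ (c.rotate m hm).support, (reprGraph X).Adj m w → IsPart w.1 m.1 := by
      intro w hw hadj
      have hw' : w ∈ c.support := by simpa using hw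
      rcases hadj.2 with h | h
      · exact absurd h.diam_lt (not_lt.2 (hmin w hw'))
      · exact h
    have hn := hc'.not_nil
    have h1 := hpar _ (SimpleGraph.Walk.getVert_mem_support _ _)
      (SimpleGraph.Walk.adj_snd hn)
    have h2 := hpar _ (SimpleGraph.Walk.getVert_mem_support _ _)
      (SimpleGraph.Walk.adj_penultimate hn).symm
    exact hc'.snd_ne_penultimate (Subtype.ext (IsNode.parent_unique (Subtype.prop _)
      (Subtype.prop _) h1 h2))

end IsTree

/-- The representing tree of a finite ultrametric space, with root the whole space. -/
def reprTree (X : Type*) [MetricSpace X] [IsUltrametricDist X] [Finite X] :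
    RootedGraphTree (Node X) where
  graph := reprGraph X
  isTree := reprGraph_isTree
  root := ⟨Set.univ, .root⟩

/-- `X` is tree-spectrum isometric: every nonempty finite ultrametric space with a representing
tree isomorphic to that of `X` and with the same spectrum as `X` is isometric to `X`. -/
def TreeSpectrumIsometric.{u} (X : Type u) [MetricSpace X] [IsUltrametricDist X] [Finite X] :
    Prop :=
  ∀ (Y : Type u) [MetricSpace Y] [IsUltrametricDist Y] [Finite Y] [Nonempty Y],
    (reprTree X).Isomorphic (reprTree Y) → spectrum X = spectrum Y → Nonempty (X ≃ᵢ Y)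

end FiniteUltrametric

/-! A finite ultrametric space is the same thing as its representing tree with every node labelled
by its diameter. The labels vanish at the leaves and strictly decrease downwards, and their values
form the spectrum (`spectrum_eq_range_diam`). Conversely, every such labelling of a tree without
out-degree one comes from a space (`exists_reprTree_iso`). Isometries correspond to label-preserving
isomorphisms, so (ii) is equivalent to `LabelRigid`, and the rest is combinatorics
(`labelRigid_iff`).

Levels imply rigidity: the internal nodes above the lowest internal level form a chain lying over
all deeper internal nodes, so the common range determines their labels from the root down. The at
most two remaining labels agree as a set; if they are crossed, the two nodes are siblings of equal
out-degree and an automorphism swaps them.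

Rigidity implies levels: label a node by a decreasing function of its level, and lower the labels on
a set closed under internal children. Two such sets can give equal ranges although no automorphism
carries one to the other, because automorphisms preserve levels, out-degrees and cardinalities. -/

namespace RootedGraphTree

/-! ### Children, ancestors and levels -/

variable {V W : Type*} {T : RootedGraphTree V}

/-- `T.Child a b`: the node `b` is a child of `a`. -/
def Child (T : RootedGraphTree V) (a b : V) : Prop := b ∈ T.children a

/-- `T.Anc a b`: the node `a` is an ancestor of `b`, possibly `b` itself. -/
def Anc (T : RootedGraphTree V) : V → V → Prop := Relation.ReflTransGen T.Child

theorem Child.adj {a b : V} (h : T.Child a b) : T.graph.Adj a b := h.1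

theorem Child.level_eq {a b : V} (h : T.Child a b) : T.level b = T.level a + 1 := h.2

theorem level_root : T.level T.root = 0 := SimpleGraph.dist_self

theorem level_eq_zero {v : V} : T.level v = 0 ↔ v = T.root := by
  rw [level, T.isTree.connected.dist_eq_zero_iff, eq_comm]

theorem adj_iff {a b : V} : T.graph.Adj a b ↔ T.Child a b ∨ T.Child b a := by
  refine ⟨fun h => ?_, fun h => h.elim Child.adj fun h => h.adj.symm⟩
  have h1 := T.isTree.dist_ne_of_adj T.root h
  rcases h.diff_dist_adj (u := T.root) with h2 | h2 | h2
  · exact absurd h2.symm h1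
  · exact Or.inl ⟨h, h2⟩
  · refine Or.inr ⟨h.symm, ?_⟩
    unfold level
    omega

/-- Shortest walks from the root to `a` and `b`, extended to `c`, are both paths; a tree has only
one, so the penultimate vertices agree. -/
theorem Child.parent_unique {a b c : V} (ha : T.Child a c) (hb : T.Child b c) : a = b := by
  obtain ⟨p, hp⟩ := T.isTree.connected.exists_walk_length_eq_dist T.root a
  obtain ⟨q, hq⟩ := T.isTree.connected.exists_walk_length_eq_dist T.root b
  have hp' : (p.concat ha.adj).IsPath := SimpleGraph.Walk.isPath_of_length_eq_dist _ (by
    rw [SimpleGraph.Walk.length_concat, hp]; exact ha.level_eq.symm)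
  have hq' : (q.concat hb.adj).IsPath := SimpleGraph.Walk.isPath_of_length_eq_dist _ (by
    rw [SimpleGraph.Walk.length_concat, hq]; exact hb.level_eq.symm)
  have h := congrArg SimpleGraph.Walk.penultimate
    ((T.isTree.existsUnique_path _ _).unique hp' hq')
  simpa using h

theorem not_child_root {a : V} : ¬ T.Child a T.root := fun h => by
  have := h.level_eq
  rw [level_root] at this
  omega

theorem exists_parent {v : V} (hv : v ≠ T.root) : ∃ u, T.Child u v := by
  obtain ⟨p, hp⟩ := T.isTree.connected.exists_walk_length_eq_dist T.root v
  have hn : ¬ p.Nil := fun h => hv h.eq.symm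
  have hadj := p.adj_penultimate hn
  rcases adj_iff.1 hadj with h | h
  · exact ⟨_, h⟩
  · have h1 := h.level_eq
    have h2 : T.level p.penultimate ≤ p.dropLast.length := SimpleGraph.dist_le _
    have h3 : p.dropLast.length + 1 = p.length := by
      conv_rhs => rw [← p.concat_dropLast hadj]
      rw [SimpleGraph.Walk.length_concat]
    have h4 : p.length = T.level v := hp
    omega

theorem anc_root (v : V) : T.Anc T.root v := by
  induction hn : T.level v generalizing v with
  | zero => rw [level_eq_zero.1 hn]; exact .refl
  | succ n ih =>
    obtain ⟨u, hu⟩ := exists_parent (T := T) (v := v) fun h => by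
      rw [level_eq_zero.2 h] at hn; omega
    exact (ih u (by have := hu.level_eq; omega)).tail hu

theorem Anc.refl (v : V) : T.Anc v v := Relation.ReflTransGen.refl

theorem Anc.trans {a b c : V} (h : T.Anc a b) (h' : T.Anc b c) : T.Anc a c :=
  Relation.ReflTransGen.trans h h'

theorem Child.anc {a b : V} (h : T.Child a b) : T.Anc a b := Relation.ReflTransGen.single h

theorem Anc.exists_child {a b : V} (h : T.Anc a b) (hne : a ≠ b) :
    ∃ c, T.Child a c ∧ T.Anc c b := by
  rcases Relation.ReflTransGen.cases_head h with h | h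
  · exact absurd h hne
  · exact h

theorem Anc.total {a b c : V} (ha : T.Anc a c) (hb : T.Anc b c) : T.Anc a b ∨ T.Anc b a := by
  have := Relation.ReflTransGen.total_of_right_unique (r := Function.swap T.Child)
    (fun _ _ _ h h' => Child.parent_unique h h')
    (Relation.reflTransGen_swap.2 ha) (Relation.reflTransGen_swap.2 hb)
  exact this.symm.imp Relation.reflTransGen_swap.1 Relation.reflTransGen_swap.1

theorem Anc.level_le {a b : V} (h : T.Anc a b) : T.level a ≤ T.level b := by
  induction h with
  | refl => exact le_rfl
  | tail _ h ih => have := Child.level_eq h; omega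

theorem Anc.eq_of_level_le {a b : V} (h : T.Anc a b) (hl : T.level b ≤ T.level a) : a = b := by
  by_contra hne
  obtain ⟨c, hc, hcb⟩ := h.exists_child hne
  have h1 := hc.level_eq
  have h2 := hcb.level_le
  omega

theorem exists_anc_level {v : V} {k : ℕ} (hk : k ≤ T.level v) :
    ∃ u, T.Anc u v ∧ T.level u = k := by
  induction hn : T.level v - k generalizing v with
  | zero => exact ⟨v, .refl v, by omega⟩
  | succ n ih =>
    obtain ⟨u, hu⟩ := exists_parent (T := T) (v := v) fun h => by
      rw [level_eq_zero.2 h] at hn; omega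
    have := hu.level_eq
    obtain ⟨w, hw, hwk⟩ := ih (v := u) (by omega) (by omega)
    exact ⟨w, hw.trans hu.anc, hwk⟩

theorem isInternal_iff {v : V} : T.IsInternal v ↔ ∃ w, T.Child v w :=
  Set.nonempty_iff_ne_empty.symm

theorem Child.isInternal {a b : V} (h : T.Child a b) : T.IsInternal a := isInternal_iff.2 ⟨b, h⟩

theorem IsLeaf.not_child {a b : V} (h : T.IsLeaf a) : ¬ T.Child a b := fun hc => hc.isInternal h

theorem IsLeaf.anc_eq {a b : V} (h : T.IsLeaf a) (hab : T.Anc a b) : a = b := by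
  by_contra hne
  obtain ⟨c, hc, -⟩ := hab.exists_child hne
  exact h.not_child hc

theorem Anc.isInternal {a b : V} (h : T.Anc a b) (hb : T.IsInternal b) : T.IsInternal a :=
  fun hl => hb (hl.anc_eq h ▸ hl)

theorem exists_leaf_anc [Finite V] (v : V) : ∃ l, T.IsLeaf l ∧ T.Anc v l := by
  obtain ⟨l, hl, hmax⟩ := Set.exists_max_image {w | T.Anc v w} T.level (Set.toFinite _)
    ⟨v, .refl v⟩
  refine ⟨l, ?_, hl⟩
  by_contra h
  obtain ⟨c, hc⟩ := isInternal_iff.1 h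
  have h1 := hmax c (Anc.trans hl hc.anc)
  have h2 := hc.level_eq
  omega

theorem IsLeaf.level_le_height [Finite V] {l : V} (h : T.IsLeaf l) : T.level l ≤ T.height :=
  le_csSup (Set.toFinite _).bddAbove ⟨l, h, rfl⟩

theorem exists_leaf_level_eq_height [Finite V] (T : RootedGraphTree V) :
    ∃ l, T.IsLeaf l ∧ T.level l = T.height := by
  obtain ⟨l, hl, -⟩ := exists_leaf_anc (T := T) T.root
  exact Nat.sSup_mem (s := T.level '' {v | T.IsLeaf v}) ⟨_, l, hl, rfl⟩ (Set.toFinite _).bddAbove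

theorem IsInternal.level_lt_height [Finite V] {v : V} (h : T.IsInternal v) :
    T.level v < T.height := by
  obtain ⟨c, hc⟩ := isInternal_iff.1 h
  obtain ⟨l, hl, hcl⟩ := exists_leaf_anc (T := T) c
  have h1 := hc.level_eq
  have h2 := hcl.level_le
  have h3 := hl.level_le_height
  omega

theorem isInternal_of_anc_level_lt {a b : V} (h : T.Anc a b) (hl : T.level a < T.level b) :
    T.IsInternal a := by
  obtain ⟨c, hc, -⟩ := h.exists_child (by rintro rfl; omega)
  exact hc.isInternal

/-! ### Invariance under rooted isomorphisms -/

section Iso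

variable {S : RootedGraphTree W}

theorem level_iso_le (f : T.graph ≃g S.graph) (hf : f T.root = S.root) (v : V) :
    S.level (f v) ≤ T.level v := by
  obtain ⟨p, hp⟩ := T.isTree.connected.exists_walk_length_eq_dist T.root v
  have := SimpleGraph.dist_le (p.map f.toHom)
  rw [SimpleGraph.Walk.length_map, hp] at this
  change S.graph.dist (f T.root) (f v) ≤ T.level v at this
  rwa [hf] at this

theorem level_iso (f : T.graph ≃g S.graph) (hf : f T.root = S.root) (v : V) :
    S.level (f v) = T.level v := by
  refine (level_iso_le f hf v).antisymm ?_
  have := level_iso_le f.symm (by rw [← hf, RelIso.symm_apply_apply]) (f v)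
  rwa [RelIso.symm_apply_apply] at this

theorem child_iso (f : T.graph ≃g S.graph) (hf : f T.root = S.root) {a b : V} :
    S.Child (f a) (f b) ↔ T.Child a b := by
  change _ ∧ _ ↔ _ ∧ _
  rw [level_iso f hf, level_iso f hf, SimpleGraph.Iso.map_adj_iff]

theorem isInternal_iso (f : T.graph ≃g S.graph) (hf : f T.root = S.root) {a : V} :
    S.IsInternal (f a) ↔ T.IsInternal a := by
  rw [isInternal_iff, isInternal_iff]
  simp only [f.surjective.exists, child_iso f hf]

theorem outDegree_iso (f : T.graph ≃g S.graph) (hf : f T.root = S.root) (a : V) :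
    S.outDegree (f a) = T.outDegree a := by
  have : S.children (f a) = f '' T.children a := by
    ext w
    obtain ⟨w, rfl⟩ := f.surjective w
    rw [f.injective.mem_set_image]
    exact child_iso f hf
  rw [outDegree, this, Set.ncard_image_of_injective _ f.injective, outDegree]

end Iso

/-! ### Labellings and rigidity -/

/-- A labelling of the nodes of a rooted tree: it vanishes on the leaves and strictly decreases
from every node to its children. -/
structure IsLabeling (T : RootedGraphTree V) (f : V → ℝ) : Prop where
  leaf : ∀ v, T.IsLeaf v → f v = 0
  child : ∀ a b, T.Child a b → f b < f a

/-- Any two labellings with the same values differ by an automorphism of the tree. -/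
def LabelRigid (T : RootedGraphTree V) : Prop :=
  ∀ f g : V → ℝ, T.IsLabeling f → T.IsLabeling g → Set.range f = Set.range g →
    ∃ φ : T.graph ≃g T.graph, φ T.root = T.root ∧ ∀ v, g (φ v) = f v

namespace IsLabeling

variable {f : V → ℝ}

theorem anc_le (hf : T.IsLabeling f) {a b : V} (h : T.Anc a b) : f b ≤ f a := by
  induction h with
  | refl => exact le_rfl
  | tail _ h ih => exact (hf.child _ _ h).le.trans ih

theorem anc_lt (hf : T.IsLabeling f) {a b : V} (h : T.Anc a b) (hne : a ≠ b) : f b < f a := by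
  obtain ⟨c, hc, hcb⟩ := h.exists_child hne
  exact (hf.anc_le hcb).trans_lt (hf.child _ _ hc)

theorem nonneg [Finite V] (hf : T.IsLabeling f) (v : V) : 0 ≤ f v := by
  obtain ⟨l, hl, hvl⟩ := exists_leaf_anc (T := T) v
  exact hf.leaf l hl ▸ hf.anc_le hvl

theorem pos_iff [Finite V] (hf : T.IsLabeling f) {v : V} : 0 < f v ↔ T.IsInternal v := by
  refine ⟨fun h hl => h.ne' (hf.leaf v hl), fun h => ?_⟩
  obtain ⟨c, hc⟩ := isInternal_iff.1 h
  exact (hf.nonneg c).trans_lt (hf.child _ _ hc)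

theorem comp_iso {S : RootedGraphTree W} (φ : S.graph ≃g T.graph) (hφ : φ S.root = T.root)
    (hf : T.IsLabeling f) : S.IsLabeling (fun v => f (φ v)) where
  leaf v hv := hf.leaf _ (by
    by_contra h
    exact (isInternal_iso φ hφ).1 h hv)
  child a b h := hf.child _ _ ((child_iso φ hφ).2 h)

end IsLabeling

/-! ### Automorphisms exchanging two siblings -/

theorem exists_iso_of_involutive {φ : V → V} (hφ : Function.Involutive φ)
    (h : ∀ a b, T.Child a b → T.Child (φ a) (φ b)) : ∃ e : T.graph ≃g T.graph, ⇑e = φ := by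
  have hadj : ∀ a b, T.graph.Adj a b → T.graph.Adj (φ a) (φ b) := fun a b hab =>
    adj_iff.2 ((adj_iff.1 hab).imp (h a b) (h b a))
  refine ⟨⟨hφ.toPerm, fun {a b} => ⟨fun hab => ?_, hadj a b⟩⟩, rfl⟩
  have := hadj _ _ hab
  rwa [hφ.coe_toPerm, hφ, hφ] at this

/-- Two siblings of the same out-degree, all of whose children are leaves, are exchanged by an
automorphism which fixes all other internal nodes. -/
theorem exists_swap [Finite V] {p u w : V} (hpu : T.Child p u) (hpw : T.Child p w) (huw : u ≠ w)
    (hu : ∀ c, T.Child u c → T.IsLeaf c) (hw : ∀ c, T.Child w c → T.IsLeaf c)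
    (hdeg : T.outDegree u = T.outDegree w) :
    ∃ e : T.graph ≃g T.graph, e T.root = T.root ∧ e u = w ∧ e w = u ∧
      ∀ v, T.IsInternal v → v ≠ u → v ≠ w → e v = v := by
  classical
  obtain ⟨ε⟩ : Nonempty (T.children u ≃ T.children w) := Finite.card_eq.1 hdeg
  -- Nothing lies below the children of `u` and `w`, so moving these two nodes and their children
  -- suffices.
  set φ : V → V := fun x =>
    if x = u then w else if x = w then u
    else if h : T.Child u x then (ε ⟨x, h⟩).1
    else if h : T.Child w x then (ε.symm ⟨x, h⟩).1 else x with hφdef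
  have hlev : T.level u = T.level w := by rw [hpu.level_eq, hpw.level_eq]
  have huu : ∀ {c}, T.Child u c → c ≠ u ∧ c ≠ w ∧ ¬ T.Child w c := fun {c} hc =>
    ⟨fun h => by have := hc.level_eq; rw [h] at this; omega,
     fun h => by have := hc.level_eq; rw [h] at this; omega,
     fun h => huw (hc.parent_unique h)⟩
  have hww : ∀ {c}, T.Child w c → c ≠ u ∧ c ≠ w ∧ ¬ T.Child u c := fun {c} hc =>
    ⟨fun h => by have := hc.level_eq; rw [h] at this; omega,
     fun h => by have := hc.level_eq; rw [h] at this; omega,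
     fun h => huw (h.parent_unique hc)⟩
  have φu : φ u = w := by simp [hφdef]
  have φw : φ w = u := by simp [hφdef, huw.symm]
  have φcu : ∀ {c} (h : T.Child u c), φ c = (ε ⟨c, h⟩).1 := fun {c} h => by
    simp [hφdef, huu h, h]
  have φcw : ∀ {c} (h : T.Child w c), φ c = (ε.symm ⟨c, h⟩).1 := fun {c} h => by
    simp [hφdef, hww h, h]
  have φo : ∀ {c}, c ≠ u → c ≠ w → ¬ T.Child u c → ¬ T.Child w c → φ c = c :=
    fun {c} h1 h2 h3 h4 => by simp [hφdef, h1, h2, h3, h4]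
  have φcu' : ∀ {c}, T.Child u c → T.Child w (φ c) := fun {c} h => by
    rw [φcu h]; exact (ε ⟨c, h⟩).2
  have φcw' : ∀ {c}, T.Child w c → T.Child u (φ c) := fun {c} h => by
    rw [φcw h]; exact (ε.symm ⟨c, h⟩).2
  have hinv : Function.Involutive φ := by
    intro c
    by_cases h1 : c = u
    · rw [h1, φu, φw]
    by_cases h2 : c = w
    · rw [h2, φw, φu]
    by_cases h3 : T.Child u c
    · rw [φcw (φcu' h3)]
      simp only [φcu h3, Subtype.coe_eta, Equiv.symm_apply_apply]
    by_cases h4 : T.Child w c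
    · rw [φcu (φcw' h4)]
      simp only [φcw h4, Subtype.coe_eta, Equiv.apply_symm_apply]
    rw [φo h1 h2 h3 h4, φo h1 h2 h3 h4]
  have hchild : ∀ a b, T.Child a b → T.Child (φ a) (φ b) := by
    intro a b hab
    by_cases h1 : a = u
    · subst h1; rw [φu]; exact φcu' hab
    by_cases h2 : a = w
    · subst h2; rw [φw]; exact φcw' hab
    rw [φo h1 h2 (fun h => (hu _ h).not_child hab) (fun h => (hw _ h).not_child hab)]
    by_cases h3 : b = u
    · subst h3; rw [φu, hab.parent_unique hpu]; exact hpw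
    by_cases h4 : b = w
    · subst h4; rw [φw, hab.parent_unique hpw]; exact hpu
    rwa [φo h3 h4 (fun h => h1 (hab.parent_unique h)) (fun h => h2 (hab.parent_unique h))]
  obtain ⟨e, he⟩ := exists_iso_of_involutive hinv hchild
  refine ⟨e, ?_, by rw [he, φu], by rw [he, φw], fun v hv h1 h2 => ?_⟩
  · rw [he, φo (fun h => not_child_root (h ▸ hpu)) (fun h => not_child_root (h ▸ hpw))
      not_child_root not_child_root]
  · rw [he, φo h1 h2 (fun h => hv (hu _ h)) (fun h => hv (hw _ h))]

theorem anc_of_unique_level {v w : V} (hw : T.IsInternal w) (hl : T.level v ≤ T.level w)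
    (huniq : ∀ x, T.IsInternal x → T.level x = T.level v → x = v) : T.Anc v w := by
  obtain ⟨x, hx, hxl⟩ := exists_anc_level hl
  exact huniq x (hx.isInternal hw) hxl ▸ hx

/-! ### The level conditions imply rigidity -/

section Sufficiency

variable [Finite V] {f g : V → ℝ}

theorem exists_isInternal_level_eq {j : ℕ} (hj : j < T.height) :
    ∃ v, T.IsInternal v ∧ T.level v = j := by
  obtain ⟨l, -, hl⟩ := T.exists_leaf_level_eq_height
  obtain ⟨v, hv, hvj⟩ := exists_anc_level (T := T) (v := l) (k := j) (by omega)
  exact ⟨v, isInternal_of_anc_level_lt hv (by omega), hvj⟩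

/-- Choose `w` with `g w = f v`. If `w` were on a higher level, it would be an ancestor of `v` with
`f w = f v`, against strict decrease. So `v` is an ancestor of `w`, and `f v = g w ≤ g v`. -/
theorem IsLabeling.le_of_range_subset (hf : T.IsLabeling f) (hg : T.IsLabeling g)
    (hfg : Set.range f ⊆ Set.range g) {v : V} (hv : T.IsInternal v)
    (huniq : ∀ x, T.IsInternal x → T.level x = T.level v → x = v)
    (hlt : ∀ x, T.IsInternal x → T.level x < T.level v → T.Anc x v ∧ f x = g x) :
    f v ≤ g v := by
  obtain ⟨w, hw⟩ := hfg ⟨v, rfl⟩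
  have hwi : T.IsInternal w := hg.pos_iff.1 (hw ▸ hf.pos_iff.2 hv)
  rcases lt_or_ge (T.level w) (T.level v) with h | h
  · obtain ⟨ha, he⟩ := hlt w hwi h
    have := hf.anc_lt ha (by rintro rfl; omega)
    rw [he, hw] at this
    exact absurd this (lt_irrefl _)
  · exact hw ▸ hg.anc_le (anc_of_unique_level hwi h huniq)

theorem IsLabeling.eq_of_range_eq (hf : T.IsLabeling f) (hg : T.IsLabeling g)
    (hfg : Set.range f = Set.range g) {n : ℕ}
    (huniq : ∀ x y, T.IsInternal x → T.IsInternal y → T.level x = T.level y → T.level x < n →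
      x = y) {v : V} (hv : T.IsInternal v) (hvn : T.level v < n) : f v = g v := by
  induction hk : T.level v using Nat.strong_induction_on generalizing v with
  | _ k ih =>
    subst hk
    have huniq' : ∀ x, T.IsInternal x → T.level x = T.level v → x = v := fun x hx hxl =>
      huniq x v hx hv hxl (by omega)
    have hanc : ∀ x, T.IsInternal x → T.level x < T.level v → T.Anc x v := fun x hx hxl =>
      anc_of_unique_level hv hxl.le fun y hy hyl => huniq y x hy hx hyl (by omega)
    exact le_antisymm
      (hf.le_of_range_subset hg hfg.le hv huniq' fun x hx hxl =>
        ⟨hanc x hx hxl, ih _ hxl hx (by omega) rfl⟩)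
      (hg.le_of_range_subset hf hfg.ge hv huniq' fun x hx hxl =>
        ⟨hanc x hx hxl, (ih _ hxl hx (by omega) rfl).symm⟩)

/-- The values of a labelling on the lowest level of internal nodes. -/
theorem IsLabeling.image_subset_of_range_subset (hf : T.IsLabeling f) (hg : T.IsLabeling g)
    (hfg : Set.range f ⊆ Set.range g)
    (huniq : ∀ x y, T.IsInternal x → T.IsInternal y → T.level x = T.level y →
      T.level x + 1 < T.height → x = y)
    (heq : ∀ x, T.IsInternal x → T.level x + 1 < T.height → f x = g x) :
    f '' {v | T.IsInternal v ∧ T.level v + 1 = T.height} ⊆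
      g '' {v | T.IsInternal v ∧ T.level v + 1 = T.height} := by
  rintro _ ⟨v, ⟨hv, hvh⟩, rfl⟩
  obtain ⟨w, hw⟩ := hfg ⟨v, rfl⟩
  have hwi : T.IsInternal w := hg.pos_iff.1 (hw ▸ hf.pos_iff.2 hv)
  have hwl := hwi.level_lt_height
  refine ⟨w, ⟨hwi, ?_⟩, hw⟩
  -- Otherwise `w` is a proper ancestor of `v` with `f w = g w = f v`.
  by_contra hne
  have hwl' : T.level w + 1 < T.height := by omega
  have ha : T.Anc w v := anc_of_unique_level hv (by omega)
    fun y hy hyl => huniq y w hy hwi hyl (by omega)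
  have := hf.anc_lt ha (by rintro rfl; omega)
  rw [heq w hwi hwl', hw] at this
  exact lt_irrefl _ this

theorem labelRigid_of_levels
    (h1 : ∀ k : ℕ, 1 ≤ k → k + 2 ≤ T.height → ∃! w : V, T.IsInternal w ∧ T.level w = k)
    (h2 : {w : V | T.IsInternal w ∧ T.level w + 1 = T.height}.ncard ≤ 2)
    (h3 : ∀ w z : V, T.IsInternal w → T.IsInternal z → w ≠ z →
      T.level w + 1 = T.height → T.level z + 1 = T.height → T.outDegree w = T.outDegree z) :
    T.LabelRigid := by
  intro f g hf hg hfg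
  have huniq : ∀ x y, T.IsInternal x → T.IsInternal y → T.level x = T.level y →
      T.level x + 1 < T.height → x = y := by
    intro x y hx hy hxy hxh
    -- The hypothesis starts at level 1; level 0 contains only the root.
    rcases Nat.eq_zero_or_pos (T.level x) with h | h
    · exact (level_eq_zero.1 h).trans (level_eq_zero.1 (hxy.symm.trans h)).symm
    · exact (h1 _ h (by omega)).unique ⟨hx, rfl⟩ ⟨hy, hxy.symm⟩
  have heq : ∀ x, T.IsInternal x → T.level x + 1 < T.height → f x = g x := fun x hx hxh =>
    hf.eq_of_range_eq hg hfg (n := T.height - 1)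
      (fun x y hx hy hxy h => huniq x y hx hy hxy (by omega)) hx (by omega)
  set U := {w : V | T.IsInternal w ∧ T.level w + 1 = T.height} with hU
  have himg : f '' U = g '' U :=
    (hf.image_subset_of_range_subset hg hfg.le huniq heq).antisymm
      (hg.image_subset_of_range_subset hf hfg.ge huniq fun x hx hxh => (heq x hx hxh).symm)
  have hid : (∀ u ∈ U, f u = g u) →
      ∃ φ : T.graph ≃g T.graph, φ T.root = T.root ∧ ∀ v, g (φ v) = f v := by
    intro h
    refine ⟨SimpleGraph.Iso.refl, rfl, fun v => ?_⟩
    change g v = f v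
    by_cases hv : T.IsLeaf v
    · rw [hf.leaf v hv, hg.leaf v hv]
    · have hl := IsInternal.level_lt_height hv
      rcases Nat.lt_or_ge (T.level v + 1) T.height with h' | h'
      · exact (heq v hv h').symm
      · exact (h v ⟨hv, by omega⟩).symm
  by_cases hsub : U.Subsingleton
  · refine hid fun u hu => ?_
    obtain ⟨w, hw, hwu⟩ := himg.le ⟨u, hu, rfl⟩
    rw [← hwu, hsub hw hu]
  · obtain ⟨u, hu, w, hw, huw⟩ := Set.not_subsingleton_iff.1 hsub
    have hUeq : U = {u, w} := by
      refine (Set.eq_of_subset_of_ncard_le ?_ ?_ (Set.toFinite _)).symm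
      · rintro x (rfl | rfl) <;> assumption
      · rw [Set.ncard_pair huw]; exact h2
    rw [hUeq, Set.image_pair, Set.image_pair, Set.pair_eq_pair_iff] at himg
    -- The labels of `u` and `w` agree in order, or are crossed; only the second case needs a swap.
    rcases himg with ⟨hfu, hfw⟩ | ⟨hfu, hfw⟩
    · refine hid fun x hx => ?_
      rw [hUeq] at hx
      rcases hx with rfl | rfl <;> assumption
    · have hne : ∀ {x y}, x ∈ U → y ∈ U → x ≠ y → x ≠ T.root := by
        rintro x y ⟨-, hx⟩ ⟨-, hy⟩ hxy rfl
        rw [level_root] at hx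
        exact hxy (level_eq_zero.1 (by omega)).symm
      obtain ⟨p, hp⟩ := exists_parent (hne hu hw huw)
      obtain ⟨q, hq⟩ := exists_parent (hne hw hu huw.symm)
      have e1 := hp.level_eq
      have e2 := hq.level_eq
      have e3 := hu.2
      have e4 := hw.2
      obtain rfl : p = q := huniq p q hp.isInternal hq.isInternal (by omega) (by omega)
      have hleaf : ∀ x ∈ U, ∀ c, T.Child x c → T.IsLeaf c := by
        rintro x ⟨-, hx⟩ c hc
        by_contra h
        have := IsInternal.level_lt_height h
        have := hc.level_eq
        omega
      obtain ⟨φ, hroot, hφu, hφw, hφ⟩ := exists_swap hp hq huw (hleaf u hu) (hleaf w hw)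
        (h3 u w hu.1 hw.1 huw hu.2 hw.2)
      refine ⟨φ, hroot, fun v => ?_⟩
      by_cases hv : T.IsLeaf v
      · rw [hf.leaf v hv, hg.leaf _ (by
          by_contra h
          exact (isInternal_iso φ hroot).1 h hv)]
      · by_cases hvu : v = u
        · rw [hvu, hφu, hfu]
        by_cases hvw : v = w
        · rw [hvw, hφw, hfw]
        rw [hφ v hv hvu hvw]
        have hl := IsInternal.level_lt_height hv
        refine (heq v hv (lt_of_le_of_ne hl fun h => ?_)).symm
        have : v ∈ U := ⟨hv, h⟩
        rw [hUeq] at this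
        rcases this with h | h <;> contradiction

end Sufficiency

/-! ### Rigidity implies the level conditions -/

section Necessity

/-- The labelling whose value at an internal node of rank `n` is `1 / (n + 1)`. -/
noncomputable def rankLabel (T : RootedGraphTree V) (ρ : V → ℕ) (v : V) : ℝ :=
  open Classical in if T.IsLeaf v then 0 else 1 / ((ρ v : ℝ) + 1)

theorem rankLabel_of_isInternal {ρ : V → ℕ} {v : V} (hv : T.IsInternal v) :
    T.rankLabel ρ v = 1 / ((ρ v : ℝ) + 1) := if_neg hv

theorem rankLabel_of_isLeaf {ρ : V → ℕ} {v : V} (hv : T.IsLeaf v) : T.rankLabel ρ v = 0 :=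
  if_pos hv

theorem isLabeling_rankLabel {ρ : V → ℕ}
    (hρ : ∀ a b, T.Child a b → T.IsInternal b → ρ a < ρ b) : T.IsLabeling (T.rankLabel ρ) where
  leaf _ := rankLabel_of_isLeaf
  child a b h := by
    rw [rankLabel_of_isInternal h.isInternal]
    by_cases hb : T.IsLeaf b
    · rw [rankLabel_of_isLeaf hb]; positivity
    · rw [rankLabel_of_isInternal hb]
      have : (ρ a : ℝ) < ρ b := by exact_mod_cast hρ a b h hb
      exact one_div_lt_one_div_of_lt (by positivity) (by linarith)

theorem range_rankLabel_subset {ρ σ : V → ℕ}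
    (h : ∀ v, T.IsInternal v → ∃ w, T.IsInternal w ∧ σ w = ρ v) :
    Set.range (T.rankLabel ρ) ⊆ Set.range (T.rankLabel σ) := by
  rintro _ ⟨v, rfl⟩
  by_cases hv : T.IsLeaf v
  · exact ⟨v, by rw [rankLabel_of_isLeaf hv, rankLabel_of_isLeaf hv]⟩
  · obtain ⟨w, hw, hwv⟩ := h v hv
    exact ⟨w, by rw [rankLabel_of_isInternal hw, rankLabel_of_isInternal hv, hwv]⟩

theorem LabelRigid.exists_iso_of_rank (hT : T.LabelRigid) {ρ σ : V → ℕ}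
    (hρ : ∀ a b, T.Child a b → T.IsInternal b → ρ a < ρ b)
    (hσ : ∀ a b, T.Child a b → T.IsInternal b → σ a < σ b)
    (hρσ : ∀ v, T.IsInternal v → ∃ w, T.IsInternal w ∧ σ w = ρ v)
    (hσρ : ∀ v, T.IsInternal v → ∃ w, T.IsInternal w ∧ ρ w = σ v) :
    ∃ φ : T.graph ≃g T.graph, φ T.root = T.root ∧ ∀ v, T.IsInternal v → σ (φ v) = ρ v := by
  obtain ⟨φ, hroot, hφ⟩ := hT _ _ (isLabeling_rankLabel hρ) (isLabeling_rankLabel hσ)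
    ((range_rankLabel_subset hρσ).antisymm (range_rankLabel_subset hσρ))
  refine ⟨φ, hroot, fun v hv => ?_⟩
  have := hφ v
  rw [rankLabel_of_isInternal hv, rankLabel_of_isInternal ((isInternal_iso φ hroot).2 hv),
    one_div, one_div, inv_inj] at this
  exact_mod_cast add_right_cancel this

/-- Lowering by one the nodes of a set `P` closed under passing to internal children does not
change the values of the level rank, except that the value `height` occurs iff `P` meets the lowest
level of internal nodes. -/
theorem LabelRigid.exists_iso_of_shift [Finite V] (hT : T.LabelRigid) {P Q : V → Prop}
    (hP : ∀ a b, T.Child a b → T.IsInternal b → P a → P b)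
    (hQ : ∀ a b, T.Child a b → T.IsInternal b → Q a → Q b)
    (hP' : ∀ j < T.height, ∃ v, T.IsInternal v ∧ T.level v = j ∧ ¬ P v)
    (hQ' : ∀ j < T.height, ∃ v, T.IsInternal v ∧ T.level v = j ∧ ¬ Q v)
    (hPQ : ∀ v, T.IsInternal v → T.level v + 1 = T.height → P v →
      ∃ w, T.IsInternal w ∧ T.level w + 1 = T.height ∧ Q w)
    (hQP : ∀ v, T.IsInternal v → T.level v + 1 = T.height → Q v →
      ∃ w, T.IsInternal w ∧ T.level w + 1 = T.height ∧ P w) :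
    ∃ φ : T.graph ≃g T.graph, φ T.root = T.root ∧ ∀ v, T.IsInternal v → (Q (φ v) ↔ P v) := by
  classical
  let rk : (V → Prop) → V → ℕ := fun P v => T.level v + if P v then 1 else 0
  have hmono : ∀ {P : V → Prop}, (∀ a b, T.Child a b → T.IsInternal b → P a → P b) →
      ∀ a b, T.Child a b → T.IsInternal b → rk P a < rk P b := by
    intro P hP a b hab hb
    have h1 := hab.level_eq
    have h2 := hP a b hab hb
    simp only [rk]
    split_ifs with h3 h4 <;> first | omega | exact absurd (h2 h3) h4
  have himg : ∀ {P Q : V → Prop},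
      (∀ j < T.height, ∃ v, T.IsInternal v ∧ T.level v = j ∧ ¬ Q v) →
      (∀ v, T.IsInternal v → T.level v + 1 = T.height → P v →
        ∃ w, T.IsInternal w ∧ T.level w + 1 = T.height ∧ Q w) →
      ∀ v, T.IsInternal v → ∃ w, T.IsInternal w ∧ rk Q w = rk P v := by
    intro P Q hQ' hPQ v hv
    have hl := hv.level_lt_height
    -- A rank below the height is attained by an unshifted node of that level; the only other
    -- possible rank is the height, attained by a shifted node of the lowest internal level.
    rcases Nat.lt_or_ge (rk P v) T.height with h | h
    · obtain ⟨w, hw, hwl, hwQ⟩ := hQ' _ h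
      exact ⟨w, hw, by simp only [rk, if_neg hwQ] at hwl ⊢; omega⟩
    · have hPv : P v := by
        by_contra hn
        simp only [rk, if_neg hn] at h
        omega
      simp only [rk, if_pos hPv] at h
      obtain ⟨w, hw, hwl, hwQ⟩ := hPQ v hv (by omega) hPv
      exact ⟨w, hw, by simp only [rk, if_pos hwQ, if_pos hPv]; omega⟩
  obtain ⟨φ, hroot, hφ⟩ := hT.exists_iso_of_rank (hmono hP) (hmono hQ) (himg hQ' hPQ)
    (himg hP' hQP)
  refine ⟨φ, hroot, fun v hv => ?_⟩
  have := hφ v hv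
  simp only [rk, level_iso φ hroot] at this
  split_ifs at this with h1 h2 h2 <;> first | omega | tauto

/-- The case of `exists_iso_of_shift` where both sets lie in the lowest level. -/
theorem LabelRigid.exists_iso_of_lowest [Finite V] (hT : T.LabelRigid) {P Q : V → Prop}
    (hP : ∀ v, P v → T.level v + 1 = T.height) (hQ : ∀ v, Q v → T.level v + 1 = T.height)
    (hP' : ∃ v, T.IsInternal v ∧ T.level v + 1 = T.height ∧ ¬ P v)
    (hQ' : ∃ v, T.IsInternal v ∧ T.level v + 1 = T.height ∧ ¬ Q v)
    (hP0 : ∃ v, T.IsInternal v ∧ P v) (hQ0 : ∃ v, T.IsInternal v ∧ Q v) :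
    ∃ φ : T.graph ≃g T.graph, φ T.root = T.root ∧ ∀ v, T.IsInternal v → (Q (φ v) ↔ P v) := by
  have hclosed : ∀ {P : V → Prop}, (∀ v, P v → T.level v + 1 = T.height) →
      ∀ a b, T.Child a b → T.IsInternal b → P a → P b := by
    intro P hP a b hab hb ha
    have h1 := hP a ha
    have h2 := hab.level_eq
    have h3 := hb.level_lt_height
    omega
  have hval : ∀ {P : V → Prop}, (∀ v, P v → T.level v + 1 = T.height) →
      (∃ v, T.IsInternal v ∧ T.level v + 1 = T.height ∧ ¬ P v) →
      ∀ j < T.height, ∃ v, T.IsInternal v ∧ T.level v = j ∧ ¬ P v := by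
    intro P hP ⟨v, hv, hvh, hvP⟩ j hj
    rcases Nat.lt_or_ge (j + 1) T.height with h | h
    · obtain ⟨w, hw, hwj⟩ := exists_isInternal_level_eq hj
      exact ⟨w, hw, hwj, fun hwP => by have := hP w hwP; omega⟩
    · exact ⟨v, hv, by omega, hvP⟩
  obtain ⟨p, hp, hpP⟩ := hP0
  obtain ⟨q, hq, hqQ⟩ := hQ0
  exact hT.exists_iso_of_shift (hclosed hP) (hclosed hQ) (hval hP hP') (hval hQ hQ')
    (fun _ _ _ _ => ⟨q, hq, hQ q hqQ, hqQ⟩) (fun _ _ _ _ => ⟨p, hp, hP p hpP, hpP⟩)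

/-- Of two internal nodes on this level, one, `w`, is off the path to some deepest leaf. Shifting
all descendants of `w`, or only those on the lowest internal level, gives the same ranks. Rigidity
would then send `w` to the lowest internal level. -/
theorem LabelRigid.unique_of_level [Finite V] (hT : T.LabelRigid) {x y : V}
    (hx : T.IsInternal x) (hy : T.IsInternal y) (hxy : T.level x = T.level y)
    (hl : T.level x + 2 ≤ T.height) : x = y := by
  by_contra hne
  obtain ⟨l, -, hlh⟩ := T.exists_leaf_level_eq_height
  obtain ⟨w, hw, hwl, hwh⟩ : ∃ w, T.IsInternal w ∧ ¬ T.Anc w l ∧ T.level w + 2 ≤ T.height := by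
    by_cases hxl : T.Anc x l
    · refine ⟨y, hy, fun hyl => ?_, by omega⟩
      rcases hxl.total hyl with h | h
      · exact hne (h.eq_of_level_le hxy.ge)
      · exact hne (h.eq_of_level_le hxy.le).symm
    · exact ⟨x, hx, hxl, hl⟩
  -- The path to the deepest leaf `l` supplies an unshifted internal node on every level.
  have hchain : ∀ j < T.height, ∃ v, T.IsInternal v ∧ T.level v = j ∧ ¬ T.Anc w v := by
    intro j hj
    obtain ⟨v, hv, hvj⟩ := exists_anc_level (T := T) (v := l) (k := j) (by omega)
    exact ⟨v, isInternal_of_anc_level_lt hv (by omega), hvj, fun h => hwl (h.trans hv)⟩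
  obtain ⟨φ, hroot, hφ⟩ := hT.exists_iso_of_shift (P := T.Anc w)
    (Q := fun v => T.Anc w v ∧ T.level v + 1 = T.height)
    (fun a b hab _ ha => ha.trans hab.anc)
    (fun a b hab hb ha => by
      have h1 := hab.level_eq
      have h2 := hb.level_lt_height
      omega)
    hchain (fun j hj => by
      obtain ⟨v, hv, hvj, h⟩ := hchain j hj
      exact ⟨v, hv, hvj, fun h' => h h'.1⟩)
    (fun v hv hvh h => ⟨v, hv, hvh, h, hvh⟩) (fun v hv hvh h => ⟨v, hv, hvh, h.1⟩)
  have h1 := ((hφ w hw).2 (.refl w)).2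
  rw [level_iso φ hroot] at h1
  omega

/-- Shifting only `x` or only `y` gives the same ranks, so an automorphism sends `x` to `y`. -/
theorem LabelRigid.outDegree_eq [Finite V] (hT : T.LabelRigid) {x y : V}
    (hx : T.IsInternal x) (hy : T.IsInternal y) (hne : x ≠ y)
    (hxh : T.level x + 1 = T.height) (hyh : T.level y + 1 = T.height) :
    T.outDegree x = T.outDegree y := by
  obtain ⟨φ, hroot, hφ⟩ := hT.exists_iso_of_lowest (P := fun v => v = x) (Q := fun v => v = y)
    (by rintro _ rfl; exact hxh) (by rintro _ rfl; exact hyh) ⟨y, hy, hyh, hne.symm⟩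
    ⟨x, hx, hxh, hne⟩ ⟨x, hx, rfl⟩ ⟨y, hy, rfl⟩
  rw [← (hφ x hx).2 rfl, outDegree_iso φ hroot]

/-- With three nodes, shifting two of them or just one gives the same ranks, but no bijection
matches the shifted sets. -/
theorem LabelRigid.ncard_le_two [Finite V] (hT : T.LabelRigid) :
    {w : V | T.IsInternal w ∧ T.level w + 1 = T.height}.ncard ≤ 2 := by
  by_contra hlt
  obtain ⟨x, y, z, ⟨hx, hxh⟩, ⟨hy, hyh⟩, ⟨hz, hzh⟩, hxy, hxz, hyz⟩ :=
    (Set.two_lt_ncard_iff (Set.toFinite _)).1 (not_le.1 hlt)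
  obtain ⟨φ, hroot, hφ⟩ := hT.exists_iso_of_lowest (P := fun v => v = x ∨ v = y)
    (Q := fun v => v = x) (by rintro _ (rfl | rfl) <;> assumption) (by rintro _ rfl; exact hxh)
    ⟨z, hz, hzh, by rintro (rfl | rfl) <;> contradiction⟩ ⟨z, hz, hzh, hxz.symm⟩
    ⟨x, hx, Or.inl rfl⟩ ⟨x, hx, rfl⟩
  exact hxy (φ.injective (((hφ x hx).2 (Or.inl rfl)).trans ((hφ y hy).2 (Or.inr rfl)).symm))

theorem labelRigid_iff [Finite V] : T.LabelRigid ↔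
    (∀ k : ℕ, 1 ≤ k → k + 2 ≤ T.height → ∃! w : V, T.IsInternal w ∧ T.level w = k) ∧
      {w : V | T.IsInternal w ∧ T.level w + 1 = T.height}.ncard ≤ 2 ∧
      ∀ w z : V, T.IsInternal w → T.IsInternal z → w ≠ z →
        T.level w + 1 = T.height → T.level z + 1 = T.height → T.outDegree w = T.outDegree z := by
  refine ⟨fun h => ⟨fun k _ hk => ?_, h.ncard_le_two, fun w z hw hz hne => h.outDegree_eq hw hz hne⟩,
    fun ⟨h1, h2, h3⟩ => labelRigid_of_levels h1 h2 h3⟩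
  obtain ⟨w, hw, hwk⟩ := exists_isInternal_level_eq (T := T) (j := k) (by omega)
  exact ⟨w, ⟨hw, hwk⟩, fun v hv => h.unique_of_level hv.1 hw (hv.2.trans hwk.symm) (by omega)⟩

end Necessity

end RootedGraphTree

namespace FiniteUltrametric

open Metric

/-! ### Diameters label the representing tree -/

section Nodes

variable {X : Type*} [MetricSpace X]

theorem IsPart.nonempty {A B : Set X} (h : IsPart A B) : B.Nonempty := by
  obtain ⟨h0, a, ha, rfl⟩ := h
  exact ⟨a, ha, by simpa using h0⟩

theorem IsPart.subset {A B : Set X} (h : IsPart A B) : B ⊆ A := by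
  obtain ⟨-, a, -, rfl⟩ := h
  exact fun x hx => hx.1

theorem IsNode.nonempty [Nonempty X] {A : Set X} (h : IsNode A) : A.Nonempty := by
  cases h with
  | root => exact Set.univ_nonempty
  | part _ h => exact h.nonempty

theorem isPart_of_mem {A : Set X} {a : X} (ha : a ∈ A) (h0 : 0 < diam A) :
    IsPart A {x ∈ A | dist a x < diam A} := ⟨h0, a, ha, rfl⟩

theorem exists_dist_eq_diam [Finite X] {A : Set X} (hA : A.Nonempty) :
    ∃ x ∈ A, ∃ y ∈ A, dist x y = diam A := by
  obtain ⟨p, hp, hmax⟩ := Set.exists_max_image (A ×ˢ A) (fun p : X × X => dist p.1 p.2)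
    (Set.toFinite _) (hA.prod hA)
  exact ⟨p.1, hp.1, p.2, hp.2, (dist_le_diam_of_mem (Set.toFinite A).isBounded hp.1 hp.2).antisymm
    (diam_le_of_forall_dist_le dist_nonneg fun x hx y hy => hmax (x, y) ⟨hx, hy⟩)⟩

theorem eq_singleton_of_diam_eq_zero [Finite X] {A : Set X} {x : X} (hx : x ∈ A)
    (h : diam A = 0) : A = {x} :=
  Set.eq_singleton_iff_unique_mem.2 ⟨hx, fun _ hy => dist_le_zero.1
    (h ▸ dist_le_diam_of_mem (Set.toFinite A).isBounded hy hx)⟩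

theorem subset_of_below {A B : Node X}
    (h : Relation.ReflTransGen (fun A B : Node X => IsPart A.1 B.1) A B) : B.1 ⊆ A.1 := by
  induction h with
  | refl => exact subset_rfl
  | tail _ h ih => exact h.subset.trans ih

variable [IsUltrametricDist X] [Finite X]

theorem IsNode.singleton_below {A : Set X} (hA : IsNode A) {x : X} (hx : x ∈ A) :
    ∃ h : IsNode ({x} : Set X),
      Relation.ReflTransGen (fun A B : Node X => IsPart A.1 B.1) ⟨A, hA⟩ ⟨{x}, h⟩ := by
  induction A using WellFoundedLT.induction with
  | _ A ih =>
    rcases (diam_nonneg (s := A)).eq_or_lt with h0 | h0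
    · obtain rfl := eq_singleton_of_diam_eq_zero hx h0.symm
      exact ⟨hA, .refl⟩
    · have hpart := isPart_of_mem hx h0
      have hlt : {y ∈ A | dist x y < diam A} < A :=
        lt_of_le_of_ne hpart.subset fun h => hpart.diam_lt.ne (congrArg diam h)
      obtain ⟨h, h'⟩ := ih _ hlt (hA.part hpart) ⟨hx, by simpa using h0⟩
      exact ⟨h, .head hpart h'⟩

theorem isNode_singleton (x : X) : IsNode ({x} : Set X) :=
  (IsNode.root.singleton_below (Set.mem_univ x)).1

/-- Take a node of least diameter containing both points: if its diameter exceeded `dist x y`, its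
part around `x` would be a smaller such node. -/
theorem exists_isNode_diam_eq_dist (x y : X) :
    ∃ A : Set X, IsNode A ∧ x ∈ A ∧ y ∈ A ∧ diam A = dist x y := by
  obtain ⟨A, ⟨hA, hx, hy⟩, hmin⟩ := Set.exists_min_image {A : Set X | IsNode A ∧ x ∈ A ∧ y ∈ A}
    diam (Set.toFinite _) ⟨Set.univ, .root, Set.mem_univ _, Set.mem_univ _⟩
  have hle := dist_le_diam_of_mem (Set.toFinite A).isBounded hx hy
  refine ⟨A, hA, hx, hy, hle.antisymm' (not_lt.1 fun hlt => ?_)⟩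
  have hpart := isPart_of_mem hx (dist_nonneg.trans_lt hlt)
  exact absurd (hmin _ ⟨hA.part hpart, ⟨hx, by simpa using dist_nonneg.trans_lt hlt⟩, hy, hlt⟩)
    (not_le.2 hpart.diam_lt)

theorem spectrum_eq_range_diam [Nonempty X] :
    spectrum X = Set.range fun A : Node X => diam A.1 := by
  ext r
  constructor
  · rintro ⟨⟨x, y⟩, rfl⟩
    obtain ⟨A, hA, -, -, h⟩ := exists_isNode_diam_eq_dist x y
    exact ⟨⟨A, hA⟩, h⟩
  · rintro ⟨A, rfl⟩
    obtain ⟨x, -, y, -, h⟩ := exists_dist_eq_diam A.2.nonempty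
    exact ⟨(x, y), h⟩

theorem reprGraph_adj_iff {A B : Node X} :
    (reprGraph X).Adj A B ↔ IsPart A.1 B.1 ∨ IsPart B.1 A.1 := by
  refine ⟨fun h => h.2, fun h => ⟨?_, h⟩⟩
  rintro rfl
  exact h.elim (fun h => h.diam_lt.false) fun h => h.diam_lt.false

/-- Children are defined by graph distance, so edges must be oriented by induction on the level. If
`A` were a part of its child `B`, uniqueness of the containing node would make `B` the parent of
`A`. -/
theorem isPart_of_child {A B : Node X} (h : (reprTree X).Child A B) : IsPart A.1 B.1 := by
  induction hn : (reprTree X).level A generalizing A B with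
  | zero =>
    refine (reprGraph_adj_iff.1 h.adj).resolve_right fun h' => ?_
    rw [RootedGraphTree.level_eq_zero.1 hn] at h'
    exact absurd (diam_mono (Set.subset_univ _) (Set.toFinite _).isBounded) (not_le.2 h'.diam_lt)
  | succ n ih =>
    refine (reprGraph_adj_iff.1 h.adj).resolve_right fun h' => ?_
    obtain ⟨C, hC⟩ := (reprTree X).exists_parent (v := A) fun h => by
      rw [RootedGraphTree.level_eq_zero.2 h] at hn
      omega
    have h1 := hC.level_eq
    have h2 := h.level_eq
    have hCA := ih hC (by omega)
    obtain rfl : C = B := Subtype.ext (C.2.parent_unique B.2 hCA h')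
    omega

theorem child_iff_isPart {A B : Node X} : (reprTree X).Child A B ↔ IsPart A.1 B.1 := by
  refine ⟨isPart_of_child, fun h => ?_⟩
  refine (RootedGraphTree.adj_iff.1 (reprGraph_adj_iff.2 (Or.inl h))).resolve_right fun h' => ?_
  exact (h.diam_lt.trans (isPart_of_child h').diam_lt).false

theorem isLabeling_diam [Nonempty X] : (reprTree X).IsLabeling fun A => diam A.1 where
  leaf A hA := by
    by_contra h0
    obtain ⟨x, hx⟩ := A.2.nonempty
    have hpart := isPart_of_mem hx (lt_of_le_of_ne diam_nonneg (Ne.symm h0))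
    exact hA.not_child (b := ⟨_, A.2.part hpart⟩) (child_iff_isPart.2 hpart)
  child _ _ h := (child_iff_isPart.1 h).diam_lt

end Nodes

/-! ### Isometries and diameter-preserving isomorphisms -/

section Isometries

variable {X Y : Type*} [MetricSpace X] [MetricSpace Y]

theorem IsPart.image (e : X ≃ᵢ Y) {A B : Set X} (h : IsPart A B) : IsPart (e '' A) (e '' B) := by
  obtain ⟨h0, a, ha, rfl⟩ := h
  refine ⟨by rwa [e.diam_image], e a, ⟨a, ha, rfl⟩, ?_⟩
  ext y
  obtain ⟨x, rfl⟩ := e.surjective y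
  simp [e.diam_image, e.dist_eq]

theorem IsNode.image (e : X ≃ᵢ Y) {A : Set X} (h : IsNode A) : IsNode (e '' A) := by
  induction h with
  | root => rw [Set.image_univ, e.range_eq_univ]; exact .root
  | part _ h ih => exact ih.part (h.image e)

/-- The map of nodes induced by an isometry. -/
def nodeEquiv (e : X ≃ᵢ Y) : Node X ≃ Node Y where
  toFun A := ⟨e '' A.1, A.2.image e⟩
  invFun A := ⟨e.symm '' A.1, A.2.image e.symm⟩
  left_inv A := Subtype.ext (by simp [Set.image_image])
  right_inv A := Subtype.ext (by simp [Set.image_image])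

theorem isPart_nodeEquiv (e : X ≃ᵢ Y) {A B : Node X} :
    IsPart (nodeEquiv e A).1 (nodeEquiv e B).1 ↔ IsPart A.1 B.1 := by
  refine ⟨fun h => ?_, fun h => h.image e⟩
  have := h.image e.symm
  rwa [← show (nodeEquiv e).symm (nodeEquiv e A) = A from Equiv.symm_apply_apply _ _,
    ← show (nodeEquiv e).symm (nodeEquiv e B) = B from Equiv.symm_apply_apply _ _]

variable [IsUltrametricDist X] [Finite X] [IsUltrametricDist Y] [Finite Y]

theorem exists_iso_of_isometry (e : X ≃ᵢ Y) :
    ∃ φ : (reprTree X).graph ≃g (reprTree Y).graph, φ (reprTree X).root = (reprTree Y).root ∧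
      ∀ A, diam (φ A).1 = diam A.1 := by
  refine ⟨⟨nodeEquiv e, fun {A B} => ?_⟩, Subtype.ext ?_, fun A => e.diam_image A.1⟩
  · change (reprGraph Y).Adj _ _ ↔ (reprGraph X).Adj _ _
    rw [reprGraph_adj_iff, reprGraph_adj_iff, isPart_nodeEquiv, isPart_nodeEquiv]
  · change e '' Set.univ = Set.univ
    rw [Set.image_univ, e.range_eq_univ]

/-- Diameters decrease from a node to its parts, so they orient each edge. -/
theorem isPart_of_diam_eq {φ : reprGraph X ≃g reprGraph Y} (hφ : ∀ A, diam (φ A).1 = diam A.1)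
    {A B : Node X} (h : IsPart A.1 B.1) : IsPart (φ A).1 (φ B).1 := by
  refine (reprGraph_adj_iff.1 (φ.map_adj_iff.2 (reprGraph_adj_iff.2 (Or.inl h)))).resolve_right
    fun h' => ?_
  have h1 := h'.diam_lt
  rw [hφ, hφ] at h1
  exact (h1.trans h.diam_lt).false

theorem exists_point_of_diam_eq [Nonempty Y] {φ : reprGraph X ≃g reprGraph Y}
    (hφ : ∀ A, diam (φ A).1 = diam A.1) (x : X) :
    ∃ y : Y, φ ⟨{x}, isNode_singleton x⟩ = ⟨{y}, isNode_singleton y⟩ := by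
  obtain ⟨y, hy⟩ := (φ ⟨{x}, isNode_singleton x⟩).2.nonempty
  exact ⟨y, Subtype.ext (eq_singleton_of_diam_eq_zero hy ((hφ _).trans diam_singleton))⟩

theorem dist_le_of_diam_eq {φ : reprGraph X ≃g reprGraph Y} (hφ : ∀ A, diam (φ A).1 = diam A.1)
    {F : X → Y} (hF : ∀ x, φ ⟨{x}, isNode_singleton x⟩ = ⟨{F x}, isNode_singleton (F x)⟩)
    (x y : X) : dist (F x) (F y) ≤ dist x y := by
  obtain ⟨A, hA, hx, hy, hd⟩ := exists_isNode_diam_eq_dist x y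
  have hmem : ∀ z ∈ A, F z ∈ (φ ⟨A, hA⟩).1 := by
    intro z hz
    obtain ⟨h, hb⟩ := hA.singleton_below hz
    have := subset_of_below (hb.lift φ fun _ _ h => isPart_of_diam_eq hφ h)
    rw [hF] at this
    exact this rfl
  rw [← hd, ← hφ ⟨A, hA⟩]
  exact dist_le_diam_of_mem (Set.toFinite _).isBounded (hmem x hx) (hmem y hy)

/-- Points are the nodes of diameter zero, so `φ` and its inverse induce mutually inverse maps of
points; neither increases distances. -/
theorem nonempty_isometry_of_diam_eq [Nonempty X] [Nonempty Y] (φ : reprGraph X ≃g reprGraph Y)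
    (hφ : ∀ A, diam (φ A).1 = diam A.1) : Nonempty (X ≃ᵢ Y) := by
  have hφ' : ∀ A, diam (φ.symm A).1 = diam A.1 := fun A => by
    rw [← hφ, RelIso.apply_symm_apply]
  choose F hF using exists_point_of_diam_eq hφ
  choose G hG using exists_point_of_diam_eq hφ'
  have hGF : ∀ x, G (F x) = x := fun x => by
    have h := hG (F x)
    rw [← hF, RelIso.symm_apply_apply] at h
    exact (Set.singleton_injective (congrArg Subtype.val h)).symm
  have hFG : ∀ y, F (G y) = y := fun y => by
    have h := hF (G y)
    rw [← hG, RelIso.apply_symm_apply] at h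
    exact (Set.singleton_injective (congrArg Subtype.val h)).symm
  refine ⟨IsometryEquiv.mk' F G hFG (Isometry.of_dist_eq fun x y => ?_)⟩
  refine (dist_le_of_diam_eq hφ hF x y).antisymm ?_
  simpa only [hGF] using dist_le_of_diam_eq hφ' hG (F x) (F y)

end Isometries

/-! ### Realizing a labelled tree by the space of its leaves -/

section Realization

open RootedGraphTree

variable {V : Type*} {T : RootedGraphTree V} {f : V → ℝ}

/-- The smallest value of `f` on a common ancestor of `a` and `b`. -/
noncomputable def ancDist (T : RootedGraphTree V) (f : V → ℝ) (a b : V) : ℝ :=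
  sInf (f '' {v | T.Anc v a ∧ T.Anc v b})

theorem ancDist_le [Finite V] {a b v : V} (ha : T.Anc v a) (hb : T.Anc v b) :
    ancDist T f a b ≤ f v :=
  csInf_le (Set.toFinite _).bddBelow ⟨v, ⟨ha, hb⟩, rfl⟩

theorem exists_ancDist_eq [Finite V] (T : RootedGraphTree V) (f : V → ℝ) (a b : V) :
    ∃ v, T.Anc v a ∧ T.Anc v b ∧ ancDist T f a b = f v := by
  have hne : (f '' {v | T.Anc v a ∧ T.Anc v b}).Nonempty :=
    ⟨_, T.root, ⟨anc_root a, anc_root b⟩, rfl⟩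
  obtain ⟨v, ⟨ha, hb⟩, h⟩ := hne.csInf_mem (Set.toFinite _)
  exact ⟨v, ha, hb, h.symm⟩

theorem ancDist_comm (a b : V) : ancDist T f a b = ancDist T f b a := by
  simp only [ancDist, and_comm]

/-- The two minimizing nodes are both ancestors of `b`, hence comparable; the upper one is a common
ancestor of `a` and `c`. -/
theorem ancDist_le_max [Finite V] (T : RootedGraphTree V) (f : V → ℝ) (a b c : V) :
    ancDist T f a c ≤ max (ancDist T f a b) (ancDist T f b c) := by
  obtain ⟨v, hva, hvb, hv⟩ := exists_ancDist_eq T f a b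
  obtain ⟨w, hwb, hwc, hw⟩ := exists_ancDist_eq T f b c
  rw [hv, hw]
  rcases hvb.total hwb with h | h
  · exact (ancDist_le hva (h.trans hwc)).trans (le_max_left _ _)
  · exact (ancDist_le (h.trans hva) hwc).trans (le_max_right _ _)

theorem ancDist_nonneg [Finite V] (hf : T.IsLabeling f) (a b : V) : 0 ≤ ancDist T f a b := by
  obtain ⟨v, -, -, h⟩ := exists_ancDist_eq T f a b
  exact h ▸ hf.nonneg v

/-- The ultrametric space on the leaves of a labelled tree. -/
@[reducible]
noncomputable def leafMetric [Finite V] {X : Type*} (hf : T.IsLabeling f)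
    (e : X ≃ {v // T.IsLeaf v}) : MetricSpace X where
  dist x y := ancDist T f (e x) (e y)
  dist_self x := ((ancDist_le (.refl _) (.refl _)).trans (hf.leaf _ (e x).2).le).antisymm
    (ancDist_nonneg hf _ _)
  dist_comm x y := ancDist_comm _ _
  dist_triangle x y z := (ancDist_le_max T f _ (e y) _).trans
    (max_le_add_of_nonneg (ancDist_nonneg hf _ _) (ancDist_nonneg hf _ _))
  eq_of_dist_eq_zero {x y} h := by
    obtain ⟨v, hx, hy, hv⟩ := exists_ancDist_eq T f (e x) (e y)
    have hleaf : T.IsLeaf v := by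
      by_contra hi
      have := hf.pos_iff.2 hi
      rw [← hv] at this
      exact this.ne' h
    exact e.injective (Subtype.ext ((hleaf.anc_eq hx).symm.trans (hleaf.anc_eq hy)))

section Cluster

variable {X : Type*}

/-- The points of `X` that correspond to the leaves below `v`. -/
def cluster (e : X ≃ {v // T.IsLeaf v}) (v : V) : Set X := {x | T.Anc v (e x).1}

variable {e : X ≃ {v // T.IsLeaf v}}

theorem eq_of_child_of_mem_cluster {v c d : V} (hc : T.Child v c) (hd : T.Child v d) {x : X}
    (hxc : x ∈ cluster e c) (hxd : x ∈ cluster e d) : c = d := by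
  have h1 := hc.level_eq
  have h2 := hd.level_eq
  rcases Anc.total hxc hxd with h | h
  · exact h.eq_of_level_le (by omega)
  · exact (h.eq_of_level_le (by omega)).symm

theorem cluster_root : cluster e T.root = Set.univ :=
  Set.eq_univ_of_forall fun _ => anc_root _

variable [Finite V]

theorem cluster_nonempty (v : V) : (cluster e v).Nonempty := by
  obtain ⟨l, hl, hvl⟩ := exists_leaf_anc (T := T) v
  exact ⟨e.symm ⟨l, hl⟩, by simpa [cluster] using hvl⟩

variable [MetricSpace X]

/-- Out-degree at least two gives leaves below distinct children of `v`; no node strictly below `v`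
is an ancestor of both, so their distance is at least `f v`. -/
theorem diam_cluster [Finite X] (hf : T.IsLabeling f) (hT : ∀ w, T.IsInternal w → 2 ≤ T.outDegree w)
    (hd : ∀ x y, dist x y = ancDist T f (e x) (e y)) (v : V) : diam (cluster e v) = f v := by
  refine (diam_le_of_forall_dist_le (hf.nonneg v)
    fun x hx y hy => (hd x y).trans_le (ancDist_le hx hy)).antisymm ?_
  by_cases hv : T.IsLeaf v
  · rw [hf.leaf v hv]; exact diam_nonneg
  obtain ⟨c, d, hc, hd', hcd⟩ := (Set.one_lt_ncard_iff (Set.toFinite _)).1 (hT v hv)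
  obtain ⟨x, hx⟩ := cluster_nonempty (e := e) c
  obtain ⟨y, hy⟩ := cluster_nonempty (e := e) d
  have hxv : x ∈ cluster e v := Anc.trans (Child.anc hc) hx
  have hyv : y ∈ cluster e v := Anc.trans (Child.anc hd') hy
  refine le_trans ?_ (dist_le_diam_of_mem (Set.toFinite _).isBounded hxv hyv)
  obtain ⟨u, hux, huy, hu⟩ := exists_ancDist_eq T f (e x) (e y)
  rw [hd, hu]
  rcases hux.total hxv with h | h
  · exact hf.anc_le h
  · by_cases hvu : v = u
    · rw [hvu]
    obtain ⟨b, hb, hbu⟩ := h.exists_child hvu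
    exact absurd ((eq_of_child_of_mem_cluster hc hb hx (hbu.trans hux)).trans
      (eq_of_child_of_mem_cluster hb hd' (hbu.trans huy) hy)) hcd

theorem part_cluster_eq [Finite X] (hf : T.IsLabeling f)
    (hT : ∀ w, T.IsInternal w → 2 ≤ T.outDegree w)
    (hd : ∀ x y, dist x y = ancDist T f (e x) (e y)) {v c : V} (hc : T.Child v c) {a : X}
    (ha : a ∈ cluster e c) :
    {x ∈ cluster e v | dist a x < diam (cluster e v)} = cluster e c := by
  rw [diam_cluster hf hT hd]
  ext x
  refine ⟨fun ⟨hx, hlt⟩ => ?_, fun hx => ⟨hc.anc.trans hx, ?_⟩⟩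
  · obtain ⟨u, hua, hux, hu⟩ := exists_ancDist_eq T f (e a) (e x)
    rw [hd, hu] at hlt
    rcases hux.total hx with h | h
    · exact absurd (hf.anc_le h) (not_le.2 hlt)
    · obtain ⟨b, hb, hbu⟩ := h.exists_child (by rintro rfl; exact hlt.false)
      obtain rfl := eq_of_child_of_mem_cluster hb hc (hbu.trans hua) ha
      exact hbu.trans hux
  · rw [hd]
    exact (ancDist_le ha hx).trans_lt (hf.child _ _ hc)

theorem isPart_cluster_iff [Finite X] (hf : T.IsLabeling f)
    (hT : ∀ w, T.IsInternal w → 2 ≤ T.outDegree w)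
    (hd : ∀ x y, dist x y = ancDist T f (e x) (e y)) {v : V} {B : Set X} :
    IsPart (cluster e v) B ↔ ∃ c, T.Child v c ∧ cluster e c = B := by
  constructor
  · rintro ⟨h0, a, ha, rfl⟩
    rw [diam_cluster hf hT hd] at h0
    have hv := hf.pos_iff.1 h0
    obtain ⟨c, hc, hca⟩ := Anc.exists_child ha fun h => hv (h ▸ (e a).2)
    exact ⟨c, hc, (part_cluster_eq hf hT hd hc hca).symm⟩
  · rintro ⟨c, hc, rfl⟩
    obtain ⟨a, ha⟩ := cluster_nonempty (e := e) c
    refine ⟨?_, a, hc.anc.trans ha, (part_cluster_eq hf hT hd hc ha).symm⟩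
    rw [diam_cluster hf hT hd]
    exact hf.pos_iff.2 hc.isInternal

/-- Nodes with a common leaf below them are comparable, and comparable nodes with equal labels
coincide. -/
theorem cluster_injective [Finite X] (hf : T.IsLabeling f)
    (hT : ∀ w, T.IsInternal w → 2 ≤ T.outDegree w)
    (hd : ∀ x y, dist x y = ancDist T f (e x) (e y)) : Function.Injective (cluster e) := by
  intro v w h
  obtain ⟨x, hx⟩ := cluster_nonempty (e := e) v
  have heq : f v = f w := by rw [← diam_cluster hf hT hd, h, diam_cluster hf hT hd]
  by_contra hne
  rcases Anc.total hx (show T.Anc w (e x).1 from h.le hx) with h' | h'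
  · exact (hf.anc_lt h' hne).ne' heq
  · exact (hf.anc_lt h' (Ne.symm hne)).ne heq

theorem isNode_cluster [Finite X] (hf : T.IsLabeling f)
    (hT : ∀ w, T.IsInternal w → 2 ≤ T.outDegree w)
    (hd : ∀ x y, dist x y = ancDist T f (e x) (e y)) (v : V) : IsNode (cluster e v) := by
  have h : T.Anc T.root v := anc_root v
  induction h with
  | refl => rw [cluster_root]; exact .root
  | tail _ h ih => exact ih.part ((isPart_cluster_iff hf hT hd).2 ⟨_, h, rfl⟩)

theorem IsNode.exists_cluster_eq [Finite X] (hf : T.IsLabeling f)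
    (hT : ∀ w, T.IsInternal w → 2 ≤ T.outDegree w)
    (hd : ∀ x y, dist x y = ancDist T f (e x) (e y)) {A : Set X} (hA : IsNode A) :
    ∃ v, cluster e v = A := by
  induction hA with
  | root => exact ⟨T.root, cluster_root⟩
  | part _ h ih =>
    obtain ⟨v, rfl⟩ := ih
    obtain ⟨c, -, hc⟩ := (isPart_cluster_iff hf hT hd).1 h
    exact ⟨c, hc⟩

theorem exists_iso_of_ancDist [Finite X] [IsUltrametricDist X] (hf : T.IsLabeling f)
    (hT : ∀ w, T.IsInternal w → 2 ≤ T.outDegree w)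
    (hd : ∀ x y, dist x y = ancDist T f (e x) (e y)) :
    ∃ φ : (reprTree X).graph ≃g T.graph, φ (reprTree X).root = T.root ∧
      ∀ A, f (φ A) = diam A.1 := by
  have hinj := cluster_injective hf hT hd
  let ψ : V ≃ Node X := Equiv.ofBijective (fun v => ⟨cluster e v, isNode_cluster hf hT hd v⟩)
    ⟨fun v w h => hinj (congrArg Subtype.val h), fun A => by
      obtain ⟨v, hv⟩ := A.2.exists_cluster_eq hf hT hd
      exact ⟨v, Subtype.ext hv⟩⟩
  have hpart : ∀ a b, IsPart (ψ a).1 (ψ b).1 ↔ T.Child a b := fun a b =>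
    (isPart_cluster_iff hf hT hd).trans
      ⟨fun ⟨c, hc, h⟩ => hinj h ▸ hc, fun h => ⟨b, h, rfl⟩⟩
  let Ψ : T.graph ≃g (reprTree X).graph := ⟨ψ, fun {a b} => by
    change (reprGraph X).Adj _ _ ↔ _
    rw [reprGraph_adj_iff, hpart, hpart, RootedGraphTree.adj_iff]⟩
  refine ⟨Ψ.symm, ?_, fun A => ?_⟩
  · rw [show (reprTree X).root = Ψ T.root from Subtype.ext cluster_root.symm,
      RelIso.symm_apply_apply]
  · obtain ⟨v, rfl⟩ := Ψ.surjective A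
    rw [RelIso.symm_apply_apply]
    exact (diam_cluster hf hT hd v).symm

end Cluster

/-- Every labelled rooted tree without nodes of out-degree one is the representing tree, labelled
by diameters, of a finite ultrametric space. -/
theorem exists_reprTree_iso.{u} [Finite V] (hf : T.IsLabeling f)
    (hT : ∀ w, T.IsInternal w → 2 ≤ T.outDegree w) :
    ∃ (X : Type u) (_ : MetricSpace X) (_ : IsUltrametricDist X) (_ : Finite X) (_ : Nonempty X)
      (φ : (reprTree X).graph ≃g T.graph), φ (reprTree X).root = T.root ∧
        ∀ A, f (φ A) = diam A.1 := by
  -- A copy of the leaves in universe `u`, which need not be that of `V`.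
  let e : ULift.{u} (Fin (Nat.card {v // T.IsLeaf v})) ≃ {v // T.IsLeaf v} :=
    Equiv.ulift.trans (Finite.equivFin _).symm
  let _ := leafMetric hf e
  obtain ⟨l, hl, -⟩ := exists_leaf_anc (T := T) T.root
  have hu : IsUltrametricDist (ULift.{u} (Fin (Nat.card {v // T.IsLeaf v}))) :=
    ⟨fun _ _ _ => ancDist_le_max T f _ _ _⟩
  exact ⟨_, inferInstance, hu, inferInstance, ⟨e.symm ⟨l, hl⟩⟩,
    exists_iso_of_ancDist (e := e) hf hT fun _ _ => rfl⟩

end Realization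

/-! ### Tree-spectrum isometry as rigidity of labellings -/

theorem treeSpectrumIsometric_of_labelRigid {V : Type*} {T : RootedGraphTree V}
    (hT : T.LabelRigid) {X : Type*} [MetricSpace X] [IsUltrametricDist X] [Finite X] [Nonempty X]
    (h : (reprTree X).Isomorphic T) : TreeSpectrumIsometric X := by
  intro Y _ _ _ _ ⟨β, hβ⟩ hsp
  obtain ⟨α, hα⟩ := h
  have hα' : α.symm T.root = (reprTree X).root := by rw [← hα, RelIso.symm_apply_apply]
  obtain ⟨φ, -, hφ⟩ := hT (fun v => diam (α.symm v).1) (fun v => diam (β (α.symm v)).1)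
    (isLabeling_diam.comp_iso α.symm hα')
    ((isLabeling_diam.comp_iso β hβ).comp_iso α.symm hα') (by
      rw [spectrum_eq_range_diam, spectrum_eq_range_diam] at hsp
      exact (α.symm.surjective.range_comp fun A : Node X => diam A.1).trans (hsp.trans
        ((β.surjective.comp α.symm.surjective).range_comp fun A : Node Y => diam A.1).symm))
  refine nonempty_isometry_of_diam_eq (((α.trans φ).trans α.symm).trans β) fun A => ?_
  have := hφ (α A)
  rw [RelIso.symm_apply_apply] at this
  exact this

theorem labelRigid_of_treeSpectrumIsometric.{u} {V : Type*} [Finite V] {T : RootedGraphTree V}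
    (hT : ∀ w, T.IsInternal w → 2 ≤ T.outDegree w)
    (h : ∀ (X : Type u) [MetricSpace X] [IsUltrametricDist X] [Finite X] [Nonempty X],
      (reprTree X).Isomorphic T → TreeSpectrumIsometric X) : T.LabelRigid := by
  intro f g hf hg hfg
  obtain ⟨X, _, _, _, _, α, hα, hfα⟩ := exists_reprTree_iso.{_, u} hf hT
  obtain ⟨Y, _, _, _, _, β, hβ, hgβ⟩ := exists_reprTree_iso.{_, u} hg hT
  obtain ⟨ε⟩ := h X ⟨α, hα⟩ Y
    ⟨α.trans β.symm, by
      change β.symm (α _) = _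
      rw [hα, ← hβ, RelIso.symm_apply_apply]⟩
    (by
      rw [spectrum_eq_range_diam, spectrum_eq_range_diam]
      simp only [← hfα, ← hgβ]
      exact (α.surjective.range_comp f).trans (hfg.trans (β.surjective.range_comp g).symm))
  obtain ⟨φ, hroot, hφ⟩ := exists_iso_of_isometry ε
  refine ⟨(α.symm.trans φ).trans β, ?_, fun v => ?_⟩
  · change β (φ (α.symm T.root)) = _
    rw [← hα, RelIso.symm_apply_apply, hroot, hβ, hα]
  · change g (β (φ (α.symm v))) = f v
    rw [hgβ, hφ, ← hfα, RelIso.apply_symm_apply]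

end FiniteUltrametric

/-- Levels are compared by addition, as `k + 2 ≤ T.height`, to avoid truncated subtraction for small
heights. -/
theorem theorem5p2 {V : Type*} [Finite V] (T : RootedGraphTree V)
    (hT : ∀ w : V, T.IsInternal w → 2 ≤ T.outDegree w) :
    ((∀ k : ℕ, 1 ≤ k → k + 2 ≤ T.height → ∃! w : V, T.IsInternal w ∧ T.level w = k) ∧
      {w : V | T.IsInternal w ∧ T.level w + 1 = T.height}.ncard ≤ 2 ∧
      ∀ w z : V, T.IsInternal w → T.IsInternal z → w ≠ z →
        T.level w + 1 = T.height → T.level z + 1 = T.height → T.outDegree w = T.outDegree z) ↔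
    ∀ (X : Type*) [MetricSpace X] [IsUltrametricDist X] [Finite X] [Nonempty X],
      (FiniteUltrametric.reprTree X).Isomorphic T →
        FiniteUltrametric.TreeSpectrumIsometric X := by
  rw [← RootedGraphTree.labelRigid_iff]
  exact ⟨fun h X _ _ _ _ hX => FiniteUltrametric.treeSpectrumIsometric_of_labelRigid h hX,
    FiniteUltrametric.labelRigid_of_treeSpectrumIsometric hT⟩
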